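/- Let $n=n_1+\dots+n_q$, $A\in\mathbb{R}^{n\times n}$, $B\in\mathbb{R}^{n\times m}$, $K\in\mathbb{R}^{m\times n}$, saturation levels $\bar u_1,\dots,\bar u_m>0$, and $0<T_1^{(i)}\le T_2^{(i)}$ for $i=1,\dots,q$. Vectors of $\mathbb{R}^n$ are split into blocks $z=(z^{(1)},\dots,z^{(q)})$, $z^{(i)}\in\mathbb{R}^{n_i}$. Put $\mathfrak{dz}(v)_i=\min(|v_i|,\bar u_i)\operatorname{sign}(v_i)-v_i$ for $v\in\mathbb{R}^m$, $$A_{cl}=\begin{bmatrix}A+BK&-BK\\0&A\end{bmatrix},\quad B_{cl}=\begin{bmatrix}B\\0\end{bmatrix},\quad K_{cl}=\begin{bmatrix}K&-K\end{bmatrix},\quad \mathcal{T}=\prod_{i=1}^q[0,T_2^{(i)}].$$ With states $x=(\bar x,\tau)\in\mathbb{R}^{2n}\times\mathbb{R}^q$, $\bar x=(x_p,\tilde\eta)$, consider the hybrid system $\dot x=f(x)$ for $x\in\mathcal{C}$, $x^+\in G(x)$ for $x\in\mathcal{D}$, where $$\mathcal{C}=\mathbb{R}^{2n}\times\mathcal{T},\qquad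 f(x)=\bigl(A_{cl}\bar x+B_{cl}\,\mathfrak{dz}(K_{cl}\bar x),\,-\mathbf{1}_q\bigr),\qquad \mathcal{D}=\{x\in\mathcal{C}:\tau_i=0\text{ for some }i\},$$ and $G(x)$ consists of all $(x_p,h_i(\tilde\eta),\chi)$ with $i$ such that $\tau_i=0$, where $h_i$ replaces the block $\tilde\eta^{(i)}$ by $0$ and keeps the other blocks, $\chi_i\in[T_1^{(i)},T_2^{(i)}]$ and $\chi_j=\tau_j$ for $j\ne i$. Solutions are hybrid arcs $(t,j)\mapsto\phi(t,j)$ on hybrid time domains in the usual sense (Goebel, Sanfelice and Teel); a solution is maximal if it cannot be extended, and complete if its domain is unbounded. Let $\mathcal{A}=\{0\}\times\mathcal{T}$ and let $|x|_{\mathcal{A}}$ be the Euclidean distance of $x$ to $\mathcal{A}$. Theorem. Suppose that there are a continuously differentiable function $V:\mathbb{R}^{2n+q}\to\mathbb{R}$, real numbers $k,c_1,c_2,c_3>0$ and a neighborhood $\mathcal{U}\subset\mathbb{R}^{2n}$ of $0$ such that $$c_1|x|_{\mathcal{A}}^k\le V(x)\le c_2|x|_{\mathcal{A}}^k\quad\forall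 x\in\mathcal{C},$$ $$\langle\nabla V(x),f(x)\rangle\le-c_3V(x)\quad\forall x\in\mathcal{U}\times\mathcal{T},$$ $$V(g)-V(x)\le0\quad\forall x\in\mathcal{D},\ g\in G(x).$$ Then $\mathcal{A}$ is exponentially stable, that is, there are $\kappa,\lambda,\mu>0$ such that every maximal solution $\phi$ with $|\phi(0,0)|_{\mathcal{A}}\le\mu$ is complete and satisfies $$|\phi(t,j)|_{\mathcal{A}}\le\kappa e^{-\lambda(t+j)}|\phi(0,0)|_{\mathcal{A}}\quad\forall(t,j)\in\operatorname{dom}\phi.$$ Moreover, for every $c\in\mathbb{R}$ such that the sublevel set $\{x\in\mathcal{C}:V(x)\le c\}$ is contained in $\mathcal{U}\times\mathcal{T}$, this sublevel set is contained in the basin of attraction of $\mathcal{A}$, that is, every maximal solution $\phi$ that starts in it is complete and satisfies $|\phi(t,j)|_{\mathcal{A}}\to0$ as $t+j\to\infty$, $(t,j)\in\operatorname{dom}\phi$. -/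

import Mathlib

/-! ### Hybrid systems -/

/-- A hybrid system `ẋ = f x` for `x ∈ C`, `x⁺ ∈ G x` for `x ∈ D`. -/
structure HybridSystem (E : Type*) where
  /-- flow map -/
  f : E → E
  /-- flow set -/
  C : Set E
  /-- (set-valued) jump map -/
  G : E → Set E
  /-- jump set -/
  D : Set E

/-- A compact hybrid time domain: `⋃_{j < J} [t_j, t_{j+1}] × {j}` with
`0 = t_0 ≤ t_1 ≤ … ≤ t_J`. -/
def IsCompactHybridTimeDomain (S : Set (ℝ × ℕ)) : Prop :=
  ∃ (J : ℕ) (t : ℕ → ℝ), t 0 = 0 ∧ (∀ j < J, t j ≤ t (j + 1)) ∧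
    S = {p | p.2 < J ∧ t p.2 ≤ p.1 ∧ p.1 ≤ t (p.2 + 1)}

/-- A (nonempty) hybrid time domain: a subset of `ℝ≥0 × ℕ` all of whose truncations
`S ∩ ([0, T] × {0, …, J})`, `(T, J) ∈ S`, are compact hybrid time domains. -/
def IsHybridTimeDomain (S : Set (ℝ × ℕ)) : Prop :=
  S.Nonempty ∧ (∀ p ∈ S, 0 ≤ p.1) ∧
    ∀ p ∈ S, IsCompactHybridTimeDomain (S ∩ {r | r.1 ≤ p.1 ∧ r.2 ≤ p.2})

/-- A hybrid arc: a function on a hybrid time domain (values of `toFun` outside of `dom` are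
irrelevant) such that `φ(·, j)` is absolutely continuous on each compact subinterval of
`I_j = {t | (t, j) ∈ dom φ}`, for each `j`. -/
structure HybridArc (E : Type*) [PseudoMetricSpace E] where
  /-- the hybrid time domain of the arc -/
  dom : Set (ℝ × ℕ)
  /-- the values of the arc -/
  toFun : ℝ → ℕ → E
  isHybridTimeDomain : IsHybridTimeDomain dom
  locallyAbsolutelyContinuous : ∀ (j : ℕ) (a b : ℝ), a ≤ b →
    (∀ t ∈ Set.Icc a b, (t, j) ∈ dom) →
    AbsolutelyContinuousOnInterval (fun t => toFun t j) a b

namespace HybridArc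

variable {E : Type*} [PseudoMetricSpace E]

/-- The interval `I_j = {t | (t, j) ∈ dom φ}`. -/
def flowInterval (φ : HybridArc E) (j : ℕ) : Set ℝ := {t | (t, j) ∈ φ.dom}

/-- An arc is complete if its domain is unbounded. -/
def IsComplete (φ : HybridArc E) : Prop := ¬ Bornology.IsBounded φ.dom

/-- `|φ(t, j)|_𝒜 → 0` as `t + j → ∞`, `(t, j) ∈ dom φ`. -/
def ConvergesTo (φ : HybridArc E) (A : Set E) : Prop :=
  ∀ ε > 0, ∃ N : ℝ, ∀ (t : ℝ) (j : ℕ), (t, j) ∈ φ.dom → N ≤ t + j →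
    Metric.infDist (φ.toFun t j) A < ε

end HybridArc

namespace HybridSystem

variable {E : Type*} [NormedAddCommGroup E] [NormedSpace ℝ E]

/-- `φ` is a solution of the hybrid system. -/
structure IsSolution (H : HybridSystem E) (φ : HybridArc E) : Prop where
  initial : φ.toFun 0 0 ∈ closure H.C ∪ H.D
  mem_flowSet : ∀ j, ∀ t ∈ interior (φ.flowInterval j), φ.toFun t j ∈ H.C
  flow : ∀ j, ∀ᵐ t : ℝ, t ∈ interior (φ.flowInterval j) →
    HasDerivAt (fun s => φ.toFun s j) (H.f (φ.toFun t j)) t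
  jump : ∀ (t : ℝ) (j : ℕ), (t, j) ∈ φ.dom → (t, j + 1) ∈ φ.dom →
    φ.toFun t j ∈ H.D ∧ φ.toFun t (j + 1) ∈ H.G (φ.toFun t j)

/-- A solution is maximal if it cannot be extended to a solution with a larger domain. -/
def IsMaximalSolution (H : HybridSystem E) (φ : HybridArc E) : Prop :=
  H.IsSolution φ ∧ ∀ ψ : HybridArc E, H.IsSolution ψ → φ.dom ⊆ ψ.dom →
    (∀ (t : ℝ) (j : ℕ), (t, j) ∈ φ.dom → ψ.toFun t j = φ.toFun t j) → ψ.dom = φ.dom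

/-- Exponential stability of the set `A`. -/
def IsExponentiallyStable (H : HybridSystem E) (A : Set E) : Prop :=
  ∃ κ lam μ : ℝ, 0 < κ ∧ 0 < lam ∧ 0 < μ ∧
    ∀ φ : HybridArc E, H.IsMaximalSolution φ → Metric.infDist (φ.toFun 0 0) A ≤ μ →
      φ.IsComplete ∧ ∀ (t : ℝ) (j : ℕ), (t, j) ∈ φ.dom →
        Metric.infDist (φ.toFun t j) A ≤
          κ * Real.exp (-lam * (t + j)) * Metric.infDist (φ.toFun 0 0) A

/-- The basin of attraction of `A`: the points from which each maximal solution is complete and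
converges to `A`. -/
def basinOfAttraction (H : HybridSystem E) (A : Set E) : Set E :=
  {ξ | ∀ φ : HybridArc E, H.IsMaximalSolution φ → φ.toFun 0 0 = ξ →
    φ.IsComplete ∧ φ.ConvergesTo A}

end HybridSystem

/-! ### The closed loop with saturated input and sporadic measurements -/

/-- Index set of the coordinates of the plant state `x_p = (x_p⁽¹⁾, …, x_p⁽q⁾)`, where
`x_p⁽ⁱ⁾ ∈ ℝ^{n_i}`; it has `n = n_1 + … + n_q` elements. -/
abbrev PlantIdx {q : ℕ} (n : Fin q → ℕ) : Type := (i : Fin q) × Fin (n i)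

/-- The space `ℝ^{2n}` of `x̄ = (x_p, η̃)`. -/
abbrev XbarSpace {q : ℕ} (n : Fin q → ℕ) : Type :=
  EuclideanSpace ℝ (PlantIdx n ⊕ PlantIdx n)

/-- The space `ℝ^{2n+q}` of `x = (x̄, τ)`, with its Euclidean norm. -/
abbrev StateSpace {q : ℕ} (n : Fin q → ℕ) : Type :=
  WithLp 2 (XbarSpace n × EuclideanSpace ℝ (Fin q))

/-- The data of the closed loop: plant matrices `A`, `B`, gain `K`, saturation levels `ū`, and
bounds `T₁⁽ⁱ⁾`, `T₂⁽ⁱ⁾` on the intersampling times. -/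
structure LoopData (q m : ℕ) (n : Fin q → ℕ) where
  A : Matrix (PlantIdx n) (PlantIdx n) ℝ
  B : Matrix (PlantIdx n) (Fin m) ℝ
  K : Matrix (Fin m) (PlantIdx n) ℝ
  ubar : Fin m → ℝ
  T₁ : Fin q → ℝ
  T₂ : Fin q → ℝ

/-- Symmetric decentralized saturation. -/
noncomputable def sat {m : ℕ} (ubar v : Fin m → ℝ) : Fin m → ℝ :=
  fun i => min |v i| (ubar i) * Real.sign (v i)

/-- Decentralized deadzone. -/
noncomputable def dz {m : ℕ} (ubar v : Fin m → ℝ) : Fin m → ℝ := sat ubar v - v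

namespace LoopData

variable {q m : ℕ} {n : Fin q → ℕ} (P : LoopData q m n)

/-- `A_cl = [A + BK, -BK; 0, A]`. -/
def Acl : Matrix (PlantIdx n ⊕ PlantIdx n) (PlantIdx n ⊕ PlantIdx n) ℝ :=
  Matrix.fromBlocks (P.A + P.B * P.K) (-(P.B * P.K)) 0 P.A

/-- `B_cl = [B; 0]`. -/
def Bcl : Matrix (PlantIdx n ⊕ PlantIdx n) (Fin m) ℝ := Matrix.fromRows P.B 0

/-- `K_cl = [K, -K]`. -/
def Kcl : Matrix (Fin m) (PlantIdx n ⊕ PlantIdx n) ℝ := Matrix.fromCols P.K (-P.K)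

/-- `𝒯 = [0, T₂⁽¹⁾] × … × [0, T₂⁽q⁾]`. -/
def timerSet : Set (EuclideanSpace ℝ (Fin q)) := {τ | ∀ i, τ i ∈ Set.Icc 0 (P.T₂ i)}

/-- `𝒟_i = {τ ∈ 𝒯 | τ_i = 0}`. -/
def timerJumpSet (i : Fin q) : Set (EuclideanSpace ℝ (Fin q)) := {τ ∈ P.timerSet | τ i = 0}

/-- The reset of the `i`-th timer: `χ_i ∈ [T₁⁽ⁱ⁾, T₂⁽ⁱ⁾]`, and `χ_k = τ_k` for `k ≠ i`. -/
def timerReset (i : Fin q) (τ : EuclideanSpace ℝ (Fin q)) : Set (EuclideanSpace ℝ (Fin q)) :=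
  {χ | χ i ∈ Set.Icc (P.T₁ i) (P.T₂ i) ∧ ∀ k, k ≠ i → χ k = τ k}

/-- The flow map `f(x) = (A_cl x̄ + B_cl dz(K_cl x̄), -1)`. -/
noncomputable def flowMap (x : StateSpace n) : StateSpace n :=
  WithLp.toLp 2
    (WithLp.toLp 2 (P.Acl.mulVec x.fst.ofLp + P.Bcl.mulVec (dz P.ubar (P.Kcl.mulVec x.fst.ofLp))),
     WithLp.toLp 2 (fun _ => (-1 : ℝ)))

/-- The flow set `𝒞 = ℝ^{2n} × 𝒯`. -/
def flowSet : Set (StateSpace n) := {x | x.snd ∈ P.timerSet}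

/-- The jump set `𝒟 = ℝ^{2n} × ⋃ i, 𝒟_i`. -/
def jumpSet : Set (StateSpace n) := {x | ∃ i, x.snd ∈ P.timerJumpSet i}

end LoopData

/-- The map `h_i`, which sets the `i`-th block of `η̃` to zero: the block-diagonal matrix with
blocks `0` (for `j = i`) and identity (for `j ≠ i`), applied to `η̃`. -/
def resetBlock {q : ℕ} {n : Fin q → ℕ} (i : Fin q) (η : PlantIdx n → ℝ) : PlantIdx n → ℝ :=
  (Matrix.blockDiagonal' (fun j : Fin q =>
    if i = j then (0 : Matrix (Fin (n j)) (Fin (n j)) ℝ) else 1)).mulVec η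

namespace LoopData

variable {q m : ℕ} {n : Fin q → ℕ} (P : LoopData q m n)

/-- The jump map `G(x) = {x_p} × ⋃_{i : τ ∈ 𝒟_i} ({h_i(η̃)} × Ĝ_i(τ))`. -/
def jumpMap (x : StateSpace n) : Set (StateSpace n) :=
  {g | ∃ i, x.snd ∈ P.timerJumpSet i ∧
    (∀ s, g.fst (Sum.inl s) = x.fst (Sum.inl s)) ∧
    (∀ s, g.fst (Sum.inr s) = resetBlock i (fun r => x.fst (Sum.inr r)) s) ∧
    g.snd ∈ P.timerReset i x.snd}

/-- The hybrid closed-loop system. -/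
noncomputable def closedLoop : HybridSystem (StateSpace n) where
  f := P.flowMap
  C := P.flowSet
  G := P.jumpMap
  D := P.jumpSet

/-- The attractor `𝒜 = {0} × 𝒯`. -/
def attractor : Set (StateSpace n) := {x | x.fst = 0 ∧ x.snd ∈ P.timerSet}

end LoopData

/-!
Why the theorem holds.

*Estimate.* In a sublevel set `{x ∈ 𝒞 | V x ≤ c}` over `U`, with `c > 0`, the derivative of `V` along
the flow at boundary points is at most `-c₃ * c < 0`, and jumps do not increase `V`. So solutions
cannot leave the set, although `U` need not be open, and `V` decays like `exp (-c₃ t)`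
(`IsIntegralCurveOn.lyapunov_decay`, `LoopData.lyapunov_le`). For this, solutions, which are only
absolutely continuous, are shown to be continuously differentiable on flow intervals, because the
flow map is continuous (`hasDerivWithinAt_Icc_of_absolutelyContinuous`). The sandwich bounds turn the
decay of `V` into decay of the distance. As timers are reset to at least `T₁ i > 0`, the number `j`
of jumps is bounded by an affine function of `t` (`LoopData.jumps_le`), so that decay in `t` is decay
in `t + j` (`LoopData.exists_exponential_bound`).

*Completeness.* The flow map is globally Lipschitz, so that it has integral curves on arbitrarily
long intervals (`LipschitzWith.exists_integralCurve`). If the domain of a maximal solution were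
bounded, its last piece could be prolonged by such a curve until a timer vanishes, and there a jump
would be possible; both contradict maximality (`LoopData.isComplete_of_isMaximalSolution`).

*Conclusion.* Since `U` is a neighborhood of the origin, some sublevel set at a positive level lies
over `U` (`LoopData.exists_sublevel_subset`). It contains all points of `𝒞` close to the attractor,
and it takes the place of sublevel sets at levels `c ≤ 0`.
-/

/-! ### Ordinary differential equations -/

section ODE

variable {E : Type*} [NormedAddCommGroup E] [NormedSpace ℝ E]

/-- An absolutely continuous curve whose derivative agrees almost everywhere with a continuous
function is continuously differentiable up to the endpoints. -/
theorem hasDerivWithinAt_Icc_of_absolutelyContinuous [CompleteSpace E] {x g : ℝ → E} {a b : ℝ}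
    (hab : a ≤ b) (hx : AbsolutelyContinuousOnInterval x a b)
    (hg : ContinuousOn g (Set.Icc a b))
    (hxg : ∀ᵐ t : ℝ, t ∈ Set.Ioo a b → HasDerivAt x (g t) t) :
    ∀ t ∈ Set.Icc a b, HasDerivWithinAt x (g t) (Set.Icc a b) t := by
  set γ : ℝ → E := Set.IccExtend hab ((Set.Icc a b).domRestrict g) with hγ
  have hγc : Continuous γ :=
    continuous_IccExtend_iff.2 (continuousOn_iff_continuous_domRestrict.1 hg)
  have hγg : ∀ t ∈ Set.Icc a b, γ t = g t := fun t ht => by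
    rw [hγ, Set.IccExtend_of_mem _ _ ht]; rfl
  set y : ℝ → E := fun t => ∫ s in a..t, γ s with hy
  have hyd : ∀ t, HasDerivAt y (γ t) t := fun t =>
    (hγc.integral_hasStrictDerivAt a t).hasDerivAt
  have hyC : ContDiff ℝ 1 y := by
    rw [contDiff_one_iff_deriv]
    refine ⟨fun t => (hyd t).differentiableAt, ?_⟩
    rwa [show deriv y = γ from funext fun t => (hyd t).deriv]
  have hxy := hx.sub hyC.contDiffOn.absolutelyContinuousOnInterval
  obtain ⟨C, hC⟩ := hxy.const_of_ae_hasDerivAt_zero (by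
    have ha : ∀ᵐ t : ℝ, t ≠ a := by simp [MeasureTheory.ae_iff]
    have hb : ∀ᵐ t : ℝ, t ≠ b := by simp [MeasureTheory.ae_iff]
    filter_upwards [hxg, ha, hb] with t ht hta htb hmem
    rw [Set.uIcc_of_le hab] at hmem
    have h := (ht ⟨lt_of_le_of_ne hmem.1 hta.symm, lt_of_le_of_ne hmem.2 htb⟩).sub (hyd t)
    rwa [hγg t hmem, sub_self] at h)
  rw [Set.uIcc_of_le hab] at hC
  intro t ht
  have h := ((hyd t).const_add C).hasDerivWithinAt (s := Set.Icc a b)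
  rw [hγg t ht] at h
  exact h.congr_of_mem (fun s hs => by rw [← hC s hs]; simp) ht

/-- Integral curves on adjacent intervals that agree at the common endpoint can be concatenated. -/
theorem IsIntegralCurveOn.exists_concat {F : E → E} {α β : ℝ → E} {a b c : ℝ}
    (hα : IsIntegralCurveOn α (fun _ => F) (Set.Icc a b)) (hab : a ≤ b) (hbc : b ≤ c)
    (hβ : IsIntegralCurveOn β (fun _ => F) (Set.Icc b c))
    (h : β b = α b) :
    ∃ γ : ℝ → E, γ a = α a ∧ IsIntegralCurveOn γ (fun _ => F) (Set.Icc a c) := by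
  classical
  set γ : ℝ → E := fun t => if t ≤ b then α t else β t with hγ
  have hγα : ∀ t ∈ Set.Icc a b, γ t = α t := fun t ht => if_pos ht.2
  have hγβ : ∀ t ∈ Set.Icc b c, γ t = β t := fun t ht => by
    rcases ht.1.eq_or_lt with rfl | hlt
    · simp [hγ, h]
    · simp [hγ, not_le.2 hlt]
  refine ⟨γ, hγα a ⟨le_rfl, hab⟩, fun t ht => ?_⟩
  rw [← Set.Icc_union_Icc_eq_Icc hab hbc]
  refine HasDerivWithinAt.union ?_ ?_
  · by_cases hm : t ∈ Set.Icc a b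
    · rw [hγα t hm]
      exact (hα t hm).congr_of_mem hγα hm
    · exact hasDerivWithinAt_iff_hasFDerivWithinAt.2
        (.of_notMem_closure (by rwa [isClosed_Icc.closure_eq]))
  · by_cases hm : t ∈ Set.Icc b c
    · rw [hγβ t hm]
      exact (hβ t hm).congr_of_mem hγβ hm
    · exact hasDerivWithinAt_iff_hasFDerivWithinAt.2
        (.of_notMem_closure (by rwa [isClosed_Icc.closure_eq]))

/-- A globally Lipschitz vector field has integral curves on each compact interval. -/
theorem LipschitzWith.exists_integralCurve [CompleteSpace E] {F : E → E} {K : NNReal}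
    (hF : LipschitzWith K F) (ξ : E) {a b : ℝ} (hab : a ≤ b) :
    ∃ γ : ℝ → E, γ a = ξ ∧
      IsIntegralCurveOn γ (fun _ => F) (Set.Icc a b) := by
  -- With step `h = 1 / (2 (K + 1))` and a ball of radius `‖F ξ‖`, the Picard-Lindelöf condition
  -- holds whatever the initial point is; longer intervals are covered by concatenation.
  set h : ℝ := 1 / (2 * (K + 1)) with hh
  have hpos : 0 < h := by positivity
  have step : ∀ (ξ : E) (a b : ℝ), a ≤ b → b ≤ a + h → ∃ γ : ℝ → E, γ a = ξ ∧
      IsIntegralCurveOn γ (fun _ => F) (Set.Icc a b) := by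
    intro ξ a b hab hbh
    have hP : IsPicardLindelof (fun _ => F) (⟨a, le_rfl, hab⟩ : Set.Icc a b) ξ
        (‖F ξ‖₊) 0 ((K + 1) * ‖F ξ‖₊) K :=
      { lipschitzOnWith := fun _ _ => hF.lipschitzOnWith
        continuousOn := fun _ _ => continuousOn_const
        norm_le := fun t _ x hx => by
          have h1 := hF.dist_le_mul x ξ
          have h2 : dist x ξ ≤ ‖F ξ‖ := by simpa using hx
          have h3 : ‖F x‖ ≤ dist (F x) (F ξ) + ‖F ξ‖ := by
            rw [dist_eq_norm]; simpa using norm_add_le (F x - F ξ) (F ξ)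
          have h4 : (K : ℝ) * dist x ξ ≤ K * ‖F ξ‖ := by gcongr
          push_cast
          linarith
        mul_max_le := by
          have h1 : max (b - a) (a - a) ≤ h := max_le (by linarith) (by linarith)
          have h2 : ((K : ℝ) + 1) * h ≤ 1 := by
            rw [hh]; field_simp; norm_num
          push_cast
          rw [sub_zero]
          calc ((K : ℝ) + 1) * ‖F ξ‖ * max (b - a) (a - a)
              ≤ ((K : ℝ) + 1) * ‖F ξ‖ * h := by gcongr
            _ = (((K : ℝ) + 1) * h) * ‖F ξ‖ := by ring
            _ ≤ 1 * ‖F ξ‖ := by gcongr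
            _ = ‖F ξ‖ := one_mul _ }
    exact hP.exists_eq_forall_mem_Icc_hasDerivWithinAt₀
  have main : ∀ (n : ℕ) (b : ℝ), a ≤ b → b ≤ a + n * h → ∃ γ : ℝ → E, γ a = ξ ∧
      IsIntegralCurveOn γ (fun _ => F) (Set.Icc a b) := by
    intro n
    induction n with
    | zero => exact fun b hab hb => step ξ a b hab (by simp at hb; linarith)
    | succ n ih =>
      intro b hab hb
      push_cast at hb
      obtain ⟨α, hα0, hα⟩ := ih (max a (b - h)) (le_max_left _ _)
        (max_le (by nlinarith [n.cast_nonneg (α := ℝ)]) (by linarith))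
      obtain ⟨β, hβ0, hβ⟩ := step (α (max a (b - h))) (max a (b - h)) b
        (max_le hab (by linarith)) (by linarith [le_max_right a (b - h)])
      obtain ⟨γ, hγ0, hγ⟩ := hα.exists_concat (le_max_left _ _)
        (max_le hab (by linarith)) hβ hβ0
      exact ⟨γ, hγ0.trans hα0, hγ⟩
  obtain ⟨n, hn⟩ := exists_nat_ge ((b - a) / h)
  exact main n b hab (by rw [div_le_iff₀ hpos] at hn; linarith)

/-- Integral curves of a continuous vector field on a compact interval are absolutely
continuous. -/
theorem IsIntegralCurveOn.absolutelyContinuousOnInterval {F : E → E}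
    {γ : ℝ → E} {a b : ℝ} (hγ : IsIntegralCurveOn γ (fun _ => F) (Set.Icc a b))
    (hF : Continuous F) (hab : a ≤ b) :
    AbsolutelyContinuousOnInterval γ a b := by
  have hc : ContinuousOn γ (Set.Icc a b) := fun t ht => (hγ t ht).continuousWithinAt
  obtain ⟨C, hC⟩ := isCompact_Icc.exists_bound_of_continuousOn (hF.comp_continuousOn hc)
  have : LipschitzOnWith C.toNNReal γ (Set.Icc a b) :=
    (convex_Icc a b).lipschitzOnWith_of_nnnorm_hasDerivWithin_le hγ fun t ht => by
      rw [← NNReal.coe_le_coe]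
      exact (hC t ht).trans (Real.le_coe_toNNReal C)
  rw [← Set.uIcc_of_le hab] at this
  exact this.absolutelyContinuousOnInterval

theorem IsIntegralCurveOn.hasDerivWithinAt_Ici {F : E → E} {γ : ℝ → E} {a b : ℝ}
    (hγ : IsIntegralCurveOn γ (fun _ => F) (Set.Icc a b)) {t : ℝ} (ht : t ∈ Set.Ico a b) :
    HasDerivWithinAt γ (F (γ t)) (Set.Ici t) t :=
  (hγ t ⟨ht.1, ht.2.le⟩).mono_of_mem_nhdsWithin (Icc_mem_nhdsGE_of_mem ht)

/-- Forward uniqueness of integral curves of a Lipschitz vector field. -/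
theorem LipschitzWith.integralCurve_unique {F : E → E} {K : NNReal} (hF : LipschitzWith K F)
    {α β : ℝ → E} {a b : ℝ} (hα : IsIntegralCurveOn α (fun _ => F) (Set.Icc a b))
    (hβ : IsIntegralCurveOn β (fun _ => F) (Set.Icc a b)) (h : α a = β a) :
    Set.EqOn α β (Set.Icc a b) :=
  ODE_solution_unique (v := fun _ => F) (fun _ => hF)
    hα.continuousOn (fun _ ht => hα.hasDerivWithinAt_Ici ht)
    hβ.continuousOn (fun _ ht => hβ.hasDerivWithinAt_Ici ht) h

/-- A linear functional that is constant on the values of a vector field is affine along the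
integral curves. -/
theorem IsIntegralCurveOn.clm_apply_eq {F : E → E} {γ : ℝ → E} {a b c : ℝ}
    (hγ : IsIntegralCurveOn γ (fun _ => F) (Set.Icc a b)) (ℓ : E →L[ℝ] ℝ)
    (hℓ : ∀ x, ℓ (F x) = c) {t : ℝ} (ht : t ∈ Set.Icc a b) :
    ℓ (γ t) = ℓ (γ a) + c * (t - a) := by
  have hd : ∀ s ∈ Set.Ico a b,
      HasDerivWithinAt (fun s => ℓ (γ s) - c * s) 0 (Set.Ici s) s := by
    intro s hs
    have h := (ℓ.hasFDerivAt.comp_hasDerivWithinAt s (hγ.hasDerivWithinAt_Ici hs)).sub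
      ((hasDerivWithinAt_id s (Set.Ici s)).const_mul c)
    rw [hℓ, mul_one, sub_self] at h
    exact h
  have hc : ContinuousOn (fun s => ℓ (γ s) - c * s) (Set.Icc a b) :=
    (ℓ.continuous.comp_continuousOn hγ.continuousOn).sub (by fun_prop)
  have := constant_of_has_deriv_right_zero hc hd t ht
  linarith

end ODE

/-- Lyapunov decay along an integral curve that starts in a sublevel set `{x ∈ C | V x ≤ c}`. At the
boundary of the sublevel set the derivative of `V` is at most `-d * c < 0`, so that the curve cannot
leave it; hence the differential inequality holds at all times, and it integrates to exponential
decay. -/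
theorem IsIntegralCurveOn.lyapunov_decay {E : Type*} [NormedAddCommGroup E]
    [InnerProductSpace ℝ E] [CompleteSpace E] {F : E → E} {γ : ℝ → E} {a b : ℝ}
    (hγ : IsIntegralCurveOn γ (fun _ => F) (Set.Icc a b)) (hab : a ≤ b)
    {V : E → ℝ} (hV : Differentiable ℝ V) {C : Set E} {c d : ℝ} (hc : 0 < c) (hd : 0 < d)
    (hγC : ∀ t ∈ Set.Icc a b, γ t ∈ C)
    (hVF : ∀ x ∈ C, V x ≤ c → inner ℝ (gradient V x) (F x) ≤ -d * V x)
    (ha : V (γ a) ≤ c) : V (γ b) ≤ Real.exp (-d * (b - a)) * V (γ a) := by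
  have hVγ : ContinuousOn (fun t => V (γ t)) (Set.Icc a b) :=
    hV.continuous.comp_continuousOn hγ.continuousOn
  have hderiv : ∀ t ∈ Set.Ico a b, HasDerivWithinAt (fun t => V (γ t))
      (inner ℝ (gradient V (γ t)) (F (γ t))) (Set.Ici t) t := by
    intro t ht
    rw [inner_gradient_left]
    exact (hV (γ t)).hasFDerivAt.comp_hasDerivWithinAt t (hγ.hasDerivWithinAt_Ici ht)
  have hle : ∀ t ∈ Set.Icc a b, V (γ t) ≤ c :=
    image_le_of_deriv_right_lt_deriv_boundary (B := fun _ => c) (B' := fun _ => 0) hVγ hderiv ha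
      (fun t => hasDerivAt_const t c) fun t ht htc => by
        have := hVF (γ t) (hγC t ⟨ht.1, ht.2.le⟩) htc.le
        rw [htc] at this
        nlinarith
  have hexp : ∀ t, HasDerivAt (fun s => Real.exp (d * (s - a))) (Real.exp (d * (t - a)) * d) t := by
    intro t
    have := (((hasDerivAt_id t).sub_const a).const_mul d).exp
    simpa using this
  have hmono := image_le_of_deriv_right_le_deriv_boundary
    (f := fun t => Real.exp (d * (t - a)) * V (γ t)) (B := fun _ => V (γ a)) (B' := fun _ => 0)
    ((by fun_prop : Continuous fun t => Real.exp (d * (t - a))).continuousOn.mul hVγ)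
    (fun t ht => (hexp t).hasDerivWithinAt.mul (hderiv t ht)) (by simp) continuousOn_const
    (fun t _ => hasDerivWithinAt_const t _ _) (fun t ht => by
      have hm : t ∈ Set.Icc a b := ⟨ht.1, ht.2.le⟩
      have := hVF (γ t) (hγC t hm) (hle t hm)
      have h0 := Real.exp_pos (d * (t - a))
      nlinarith) (x := b) ⟨hab, le_rfl⟩
  rw [neg_mul, Real.exp_neg, inv_mul_eq_div, le_div_iff₀ (Real.exp_pos _), mul_comm]
  exact hmono

/-! ### Hybrid time domains -/

namespace IsHybridTimeDomain

variable {S : Set (ℝ × ℕ)}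

/-- The truncation of a hybrid time domain at one of its points `(t, j)` is a compact hybrid time
domain with exactly `j + 1` slices, the last of which ends at `t`. -/
theorem exists_switching_times (hS : IsHybridTimeDomain S) {t : ℝ} {j : ℕ} (h : (t, j) ∈ S) :
    ∃ s : ℕ → ℝ, s 0 = 0 ∧ (∀ i < j + 1, s i ≤ s (i + 1)) ∧ s (j + 1) = t ∧
      ∀ r i, ((r, i) ∈ S ∧ r ≤ t ∧ i ≤ j) ↔ i < j + 1 ∧ s i ≤ r ∧ r ≤ s (i + 1) := by
  obtain ⟨N, s, h0, hmono, hs⟩ := hS.2.2 _ h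
  have key : ∀ r i, ((r, i) ∈ S ∧ r ≤ t ∧ i ≤ j) ↔ i < N ∧ s i ≤ r ∧ r ≤ s (i + 1) :=
    fun r i => Set.ext_iff.1 hs (r, i)
  have hjN := (key t j).1 ⟨h, le_rfl, le_rfl⟩
  have hN : N = j + 1 := by
    by_contra hne
    have hlt : j + 1 < N := by omega
    have := ((key (s (j + 1)) (j + 1)).2 ⟨hlt, le_rfl, hmono _ hlt⟩).2.2
    omega
  subst hN
  refine ⟨s, h0, hmono, le_antisymm ?_ hjN.2.2, key⟩
  exact ((key (s (j + 1)) j).2 ⟨by omega, hmono _ (by omega), le_rfl⟩).2.1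

theorem zero_mem (hS : IsHybridTimeDomain S) : ((0 : ℝ), 0) ∈ S := by
  obtain ⟨⟨t, j⟩, h⟩ := hS.1
  obtain ⟨s, h0, hmono, -, hs⟩ := hS.exists_switching_times h
  exact ((hs 0 0).2 ⟨by omega, h0.le, h0 ▸ hmono 0 (by omega)⟩).1

/-- The slices of a hybrid time domain are intervals. -/
theorem mem_of_mem_Icc (hS : IsHybridTimeDomain S) {a b t : ℝ} {j : ℕ} (ha : (a, j) ∈ S)
    (hb : (b, j) ∈ S) (ht : t ∈ Set.Icc a b) : (t, j) ∈ S := by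
  obtain ⟨s, -, -, hsb, hs⟩ := hS.exists_switching_times hb
  have h1 := (hs a j).1 ⟨ha, ht.1.trans ht.2, le_rfl⟩
  exact ((hs t j).2 ⟨h1.1, h1.2.1.trans ht.1, hsb.symm ▸ ht.2⟩).1

/-- Each nonempty slice of a hybrid time domain has a least element `a`, at which the previous
slice is left. -/
theorem exists_slice_start (hS : IsHybridTimeDomain S) {t : ℝ} {j : ℕ} (h : (t, j) ∈ S) :
    ∃ a, (a, j) ∈ S ∧ (∀ r, (r, j) ∈ S → a ≤ r) ∧ (j = 0 → a = 0) ∧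
      ∀ i, j = i + 1 → (a, i) ∈ S := by
  obtain ⟨s, h0, hmono, hst, hs⟩ := hS.exists_switching_times h
  have hle := hmono j (by omega)
  refine ⟨s j, ((hs (s j) j).2 ⟨by omega, le_rfl, hle⟩).1, fun r hr => ?_, ?_, ?_⟩
  · rcases le_total r t with hrt | hrt
    · exact ((hs r j).1 ⟨hr, hrt, le_rfl⟩).2.1
    · exact (hle.trans hst.le).trans hrt
  · rintro rfl; exact h0
  · rintro i rfl
    exact ((hs (s (i + 1)) i).2 ⟨by omega, hmono i (by omega), le_rfl⟩).1

/-- Induction along a hybrid time domain, through flow intervals and jumps. -/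
theorem induction (hS : IsHybridTimeDomain S) {p : ℝ → ℕ → Prop} (zero : p 0 0)
    (flow : ∀ a b j, a ≤ b → (a, j) ∈ S → (b, j) ∈ S → p a j → p b j)
    (jump : ∀ t j, (t, j) ∈ S → (t, j + 1) ∈ S → p t j → p t (j + 1)) :
    ∀ t j, (t, j) ∈ S → p t j := by
  intro t j
  induction j generalizing t with
  | zero =>
    intro h
    exact flow 0 t 0 (hS.2.1 _ h) hS.zero_mem h zero
  | succ j ih =>
    intro h
    obtain ⟨a, ha, hmin, -, hprev⟩ := hS.exists_slice_start h
    exact flow a t (j + 1) (hmin t h) ha h (jump a j (hprev j rfl) ha (ih a (hprev j rfl)))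

/-- Before a hybrid time domain reaches slice `j`, it jumps out of each slice `i < j`. -/
theorem exists_jump_time (hS : IsHybridTimeDomain S) {t : ℝ} {i j : ℕ} (hij : i < j)
    (h : (t, j) ∈ S) : ∃ r ≤ t, (r, i) ∈ S ∧ (r, i + 1) ∈ S := by
  obtain ⟨s, -, hmono, hst, hs⟩ := hS.exists_switching_times h
  have h1 := (hs (s (i + 1)) i).2 ⟨by omega, hmono i (by omega), le_rfl⟩
  have h2 := (hs (s (i + 1)) (i + 1)).2 ⟨by omega, le_rfl, hmono (i + 1) (by omega)⟩
  exact ⟨_, h1.2.1, h1.1, h2.1⟩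

/-- The last slice of a hybrid time domain can be prolonged to `[a, b] × {J}`, if the earlier
slices lie in `[0, a]`. -/
theorem union_Icc (hS : IsHybridTimeDomain S) {a b : ℝ} {J : ℕ} (ha : (a, J) ∈ S)
    (hmax : ∀ r j, (r, j) ∈ S → j ≤ J) (hprev : ∀ r j, (r, j) ∈ S → j < J → r ≤ a) :
    IsHybridTimeDomain (S ∪ {p | p.1 ∈ Set.Icc a b ∧ p.2 = J}) := by
  refine ⟨hS.1.inl, ?_, ?_⟩
  · rintro p (hp | ⟨hp, -⟩)
    · exact hS.2.1 p hp
    · exact (hS.2.1 _ ha).trans hp.1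
  · rintro ⟨t, j⟩ hp
    by_cases hpS : (t, j) ∈ S
    · convert hS.2.2 _ hpS using 1
      refine Set.ext fun ⟨r, i⟩ => ⟨?_, fun h => ⟨Or.inl h.1, h.2⟩⟩
      rintro ⟨h | ⟨h, rfl⟩, h1, h2⟩
      · exact ⟨h, h1, h2⟩
      · obtain rfl : i = j := le_antisymm h2 (hmax _ _ hpS)
        exact ⟨hS.mem_of_mem_Icc ha hpS ⟨h.1, h1⟩, h1, h2⟩
    · obtain ⟨ht, rfl⟩ := hp.resolve_left hpS
      have ht : t ∈ Set.Icc a b := ht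
      obtain ⟨s, h0, hmono, hsa, hs⟩ := hS.exists_switching_times ha
      refine ⟨j + 1, Function.update s (j + 1) t, ?_, ?_, ?_⟩
      · rw [Function.update_of_ne (by omega)]; exact h0
      · intro i hi
        rw [Function.update_of_ne (by omega)]
        rcases eq_or_ne i j with rfl | hne
        · rw [Function.update_self]
          exact (hmono i hi).trans (hsa.trans_le ht.1)
        · rw [Function.update_of_ne (by omega)]
          exact hmono i hi
      · refine Set.ext fun ⟨r, i⟩ => ?_
        have hsj : s j ≤ a := hsa ▸ hmono j (by omega)
        have hsi := hs r i
        simp only [Set.mem_inter_iff, Set.mem_union, Set.mem_ofPred_eq]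
        rcases lt_trichotomy i j with hij | rfl | hij
        · rw [Function.update_of_ne (by omega), Function.update_of_ne (by omega), ← hsi]
          constructor
          · rintro ⟨h | ⟨-, h⟩, h1, h2⟩
            · exact ⟨h, hprev _ _ h hij, h2⟩
            · omega
          · rintro ⟨h, h1, h2⟩
            exact ⟨Or.inl h, h1.trans ht.1, h2⟩
        · rw [Function.update_of_ne (by omega), Function.update_self]
          constructor
          · rintro ⟨h, h1, -⟩
            refine ⟨by omega, ?_, h1⟩
            rcases le_total r a with hra | hra
            · rcases h with h | ⟨h, -⟩
              · exact (hsi.1 ⟨h, hra, le_rfl⟩).2.1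
              · exact hsj.trans h.1
            · exact hsj.trans hra
          · rintro ⟨-, h1, h2⟩
            refine ⟨?_, h2, le_rfl⟩
            rcases le_total r a with hra | hra
            · exact Or.inl (hsi.2 ⟨by omega, h1, hsa.symm ▸ hra⟩).1
            · exact Or.inr ⟨⟨hra, h2.trans ht.2⟩, rfl⟩
        · constructor
          · rintro ⟨-, -, h⟩; omega
          · rintro ⟨h, -⟩; omega

/-- A jump can be appended at a point of the last slice of a hybrid time domain. -/
theorem union_jump (hS : IsHybridTimeDomain S) {a : ℝ} {J : ℕ} (ha : (a, J) ∈ S)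
    (hmax : ∀ r j, (r, j) ∈ S → j ≤ J) :
    IsHybridTimeDomain (S ∪ {(a, J + 1)}) := by
  refine ⟨hS.1.inl, ?_, ?_⟩
  · rintro p (hp | rfl)
    · exact hS.2.1 p hp
    · exact hS.2.1 (a, J) ha
  · rintro ⟨t, j⟩ (hp | hp)
    · convert hS.2.2 _ hp using 1
      refine Set.ext fun ⟨r, i⟩ => ⟨?_, fun h => ⟨Or.inl h.1, h.2⟩⟩
      rintro ⟨h | h, h1, h2⟩
      · exact ⟨h, h1, h2⟩
      · have := hmax _ _ hp
        simp only [Set.mem_singleton_iff, Prod.mk.injEq] at h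
        simp only at h2
        omega
    · simp only [Set.mem_singleton_iff, Prod.mk.injEq] at hp
      obtain ⟨rfl, rfl⟩ := hp
      obtain ⟨s, h0, hmono, hsa, hs⟩ := hS.exists_switching_times ha
      refine ⟨J + 2, Function.update s (J + 2) t, ?_, ?_, ?_⟩
      · rw [Function.update_of_ne (by omega)]; exact h0
      · intro i hi
        rw [Function.update_of_ne (by omega)]
        rcases eq_or_ne i (J + 1) with rfl | hne
        · rw [Function.update_self, hsa]
        · rw [Function.update_of_ne (by omega)]
          exact hmono i (by omega)
      · refine Set.ext fun ⟨r, i⟩ => ?_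
        have hsi := hs r i
        simp only [Set.mem_inter_iff, Set.mem_union, Set.mem_singleton_iff, Prod.mk.injEq,
          Set.mem_ofPred_eq]
        rcases lt_trichotomy i (J + 1) with hij | rfl | hij
        · rw [Function.update_of_ne (by omega), Function.update_of_ne (by omega)]
          constructor
          · rintro ⟨h | ⟨-, h⟩, h1, h2⟩
            · have := hsi.1 ⟨h, h1, by omega⟩
              exact ⟨by omega, this.2⟩
            · omega
          · rintro ⟨-, h⟩
            have := hsi.2 ⟨hij, h⟩
            exact ⟨Or.inl this.1, this.2.1, by omega⟩
        · rw [Function.update_of_ne (by omega), Function.update_self, hsa]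
          constructor
          · rintro ⟨h | ⟨rfl, -⟩, -, -⟩
            · have := hmax _ _ h; omega
            · exact ⟨by omega, le_rfl, le_rfl⟩
          · rintro ⟨-, h1, h2⟩
            exact ⟨Or.inr ⟨le_antisymm h2 h1, rfl⟩, h2, le_rfl⟩
        · constructor
          · rintro ⟨-, -, h⟩; omega
          · rintro ⟨h, h1, h2⟩; omega

end IsHybridTimeDomain

/-! ### Solutions of hybrid systems -/

theorem HybridArc.Ioo_subset_interior_flowInterval {E : Type*} [PseudoMetricSpace E]
    (φ : HybridArc E) {a b : ℝ} {j : ℕ} (ha : (a, j) ∈ φ.dom) (hb : (b, j) ∈ φ.dom) :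
    Set.Ioo a b ⊆ interior (φ.flowInterval j) :=
  interior_maximal (fun _ ht => φ.isHybridTimeDomain.mem_of_mem_Icc ha hb ⟨ht.1.le, ht.2.le⟩)
    isOpen_Ioo

theorem HybridArc.continuousOn {E : Type*} [NormedAddCommGroup E] (φ : HybridArc E)
    {a b : ℝ} {j : ℕ} (hab : a ≤ b) (ha : (a, j) ∈ φ.dom) (hb : (b, j) ∈ φ.dom) :
    ContinuousOn (fun t => φ.toFun t j) (Set.Icc a b) := by
  have hac := φ.locallyAbsolutelyContinuous j a b hab fun t ht =>
    φ.isHybridTimeDomain.mem_of_mem_Icc ha hb ht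
  rw [← Set.uIcc_of_le hab]
  exact hac.continuousOn

namespace HybridSystem

variable {E : Type*} [NormedAddCommGroup E] [NormedSpace ℝ E] {H : HybridSystem E}
  {φ : HybridArc E}

/-- A solution stays in a closed flow set if jumps lead back to it, including at the endpoints of
flow intervals. -/
theorem IsSolution.toFun_mem_flowSet (hφ : H.IsSolution φ) (hC : IsClosed H.C) (hD : H.D ⊆ H.C)
    (hG : ∀ x ∈ H.D, H.G x ⊆ H.C) (t : ℝ) (j : ℕ) (h : (t, j) ∈ φ.dom) :
    φ.toFun t j ∈ H.C := by
  refine φ.isHybridTimeDomain.induction (p := fun t j => φ.toFun t j ∈ H.C) ?_ ?_ ?_ t j h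
  · have := hφ.initial
    rw [hC.closure_eq, Set.union_eq_self_of_subset_right hD] at this
    exact this
  · intro a b j hab ha hb hxa
    rcases hab.eq_or_lt with rfl | hlt
    · exact hxa
    · have hcont := HybridArc.continuousOn φ hab ha hb b ⟨hab, le_rfl⟩
      have hmem : b ∈ closure (Set.Ioo a b) := by
        rw [closure_Ioo hlt.ne]; exact ⟨hab, le_rfl⟩
      have := (hcont.mono Set.Ioo_subset_Icc_self).mem_closure hmem
        (t := H.C) fun t ht => hφ.mem_flowSet j t (φ.Ioo_subset_interior_flowInterval ha hb ht)
      rwa [hC.closure_eq] at this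
  · intro t j h h' _
    have := hφ.jump t j h h'
    exact hG _ this.1 this.2

/-- For a continuous flow map, solutions satisfy the differential equation at all points of a flow
interval, with one-sided derivatives at the endpoints. -/
theorem IsSolution.isIntegralCurveOn [CompleteSpace E] (hφ : H.IsSolution φ)
    (hf : Continuous H.f) {a b : ℝ} {j : ℕ} (hab : a ≤ b)
    (ha : (a, j) ∈ φ.dom) (hb : (b, j) ∈ φ.dom) :
    IsIntegralCurveOn (fun s => φ.toFun s j) (fun _ => H.f) (Set.Icc a b) := by
  refine hasDerivWithinAt_Icc_of_absolutelyContinuous (g := fun t => H.f (φ.toFun t j)) hab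
    (φ.locallyAbsolutelyContinuous j a b hab fun t ht =>
      φ.isHybridTimeDomain.mem_of_mem_Icc ha hb ht)
    (hf.comp_continuousOn (HybridArc.continuousOn φ hab ha hb)) ?_
  filter_upwards [hφ.flow j] with t ht hmem
  exact ht (φ.Ioo_subset_interior_flowInterval ha hb hmem)

/-- If the last flow interval of a maximal solution starts at `a`, then each integral curve on
`[a, b]` in the flow set that prolongs the last piece of the solution is already part of it. -/
theorem IsMaximalSolution.mem_dom_of_integralCurve (hφ : H.IsMaximalSolution φ)
    (hf : Continuous H.f) {a b : ℝ} {J : ℕ} (hab : a ≤ b) (ha : (a, J) ∈ φ.dom)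
    (hmax : ∀ r j, (r, j) ∈ φ.dom → j ≤ J) (hprev : ∀ r j, (r, j) ∈ φ.dom → j < J → r ≤ a)
    (hlast : ∀ r, (r, J) ∈ φ.dom → r ∈ Set.Icc a b) {ψ : ℝ → E}
    (hψ : IsIntegralCurveOn ψ (fun _ => H.f) (Set.Icc a b))
    (hψC : ∀ t ∈ Set.Icc a b, ψ t ∈ H.C)
    (hψφ : ∀ r, (r, J) ∈ φ.dom → ψ r = φ.toFun r J) : (b, J) ∈ φ.dom := by
  classical
  set S' : Set (ℝ × ℕ) := φ.dom ∪ {p | p.1 ∈ Set.Icc a b ∧ p.2 = J} with hS'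
  have hJ : ∀ r, (r, J) ∈ S' ↔ r ∈ Set.Icc a b := fun r =>
    ⟨fun h => h.elim (hlast r) (·.1), fun h => Or.inr ⟨h, rfl⟩⟩
  have hne : ∀ r j, j ≠ J → ((r, j) ∈ S' ↔ (r, j) ∈ φ.dom) := fun r j hj =>
    ⟨fun h => h.resolve_right fun h' => hj h'.2, Or.inl⟩
  set χ : HybridArc E :=
    { dom := S'
      toFun := fun t j => if j = J then ψ t else φ.toFun t j
      isHybridTimeDomain := φ.isHybridTimeDomain.union_Icc ha hmax hprev
      locallyAbsolutelyContinuous := by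
        intro j c d hcd hmem
        by_cases hj : j = J
        · subst hj
          simp only [if_true]
          refine (hψ.absolutelyContinuousOnInterval hf hab).mono ?_
          rw [Set.uIcc_of_le hcd, Set.uIcc_of_le hab]
          exact fun t ht => (hJ t).1 (hmem t ht)
        · simp only [if_neg hj]
          exact φ.locallyAbsolutelyContinuous j c d hcd fun t ht => (hne t j hj).1 (hmem t ht) }
    with hχ
  have hval : ∀ t j, (t, j) ∈ φ.dom → χ.toFun t j = φ.toFun t j := by
    intro t j h
    by_cases hj : j = J
    · subst hj
      simpa [hχ] using hψφ t h
    · simp [hχ, hj]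
  have hintJ : interior (χ.flowInterval J) = Set.Ioo a b := by
    rw [show χ.flowInterval J = Set.Icc a b from Set.ext hJ, interior_Icc]
  have hintne : ∀ j, j ≠ J → χ.flowInterval j = φ.flowInterval j := fun j hj =>
    Set.ext fun r => hne r j hj
  have hsol : H.IsSolution χ := by
    refine ⟨?_, ?_, ?_, ?_⟩
    · rw [hval 0 0 φ.isHybridTimeDomain.zero_mem]
      exact hφ.1.initial
    · intro j t ht
      by_cases hj : j = J
      · subst hj
        rw [hintJ] at ht
        simpa [hχ] using hψC t (Set.Ioo_subset_Icc_self ht)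
      · rw [hintne j hj] at ht
        simpa [hχ, hj] using hφ.1.mem_flowSet j t ht
    · intro j
      by_cases hj : j = J
      · subst hj
        refine Filter.Eventually.of_forall fun t ht => ?_
        rw [hintJ] at ht
        simpa [hχ] using (hψ t (Set.Ioo_subset_Icc_self ht)).hasDerivAt
          (Icc_mem_nhds ht.1 ht.2)
      · rw [hintne j hj]
        simpa [hχ, hj] using hφ.1.flow j
    · intro t j h h'
      have h'φ : (t, j + 1) ∈ φ.dom := by
        by_cases hj : j + 1 = J
        · have h1 : (t, j) ∈ φ.dom := (hne t j (by omega)).1 h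
          have h2 : t = a := le_antisymm (hprev t j h1 (by omega)) ((hJ t).1 (hj ▸ h')).1
          rw [h2, hj]; exact ha
        · exact (hne t _ hj).1 h'
      have hφ' : (t, j) ∈ φ.dom := (hne t j (by have := hmax _ _ h'φ; omega)).1 h
      rw [hval _ _ hφ', hval _ _ h'φ]
      exact hφ.1.jump t j hφ' h'φ
  have := hφ.2 χ hsol Set.subset_union_left hval
  rw [← this]
  exact (hJ b).2 ⟨hab, le_rfl⟩

/-- A maximal solution does not end at a point from which a jump is possible. -/
theorem IsMaximalSolution.exists_mem_dom_succ (hφ : H.IsMaximalSolution φ) {a : ℝ} {J : ℕ}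
    (ha : (a, J) ∈ φ.dom) (hD : φ.toFun a J ∈ H.D) (hG : (H.G (φ.toFun a J)).Nonempty) :
    ∃ r j, (r, j) ∈ φ.dom ∧ J < j := by
  classical
  by_contra! hmax
  obtain ⟨g, hg⟩ := hG
  set S' : Set (ℝ × ℕ) := φ.dom ∪ {(a, J + 1)} with hS'
  have hJ : ∀ r, (r, J + 1) ∈ S' ↔ r = a := fun r =>
    ⟨fun h => h.elim (fun h => absurd (hmax r _ h) (by omega)) fun h => congrArg Prod.fst h,
      fun h => Or.inr (by rw [h]; rfl)⟩
  have hne : ∀ r j, j ≠ J + 1 → ((r, j) ∈ S' ↔ (r, j) ∈ φ.dom) := fun r j hj =>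
    ⟨fun h => h.resolve_right fun h' => hj (congrArg Prod.snd h'), Or.inl⟩
  set χ : HybridArc E :=
    { dom := S'
      toFun := fun t j => if j = J + 1 then g else φ.toFun t j
      isHybridTimeDomain := φ.isHybridTimeDomain.union_jump ha hmax
      locallyAbsolutelyContinuous := by
        intro j c d hcd hmem
        by_cases hj : j = J + 1
        · simp only [if_pos hj]
          exact (LipschitzWith.const g).lipschitzOnWith.absolutelyContinuousOnInterval
        · simp only [if_neg hj]
          exact φ.locallyAbsolutelyContinuous j c d hcd fun t ht => (hne t j hj).1 (hmem t ht) }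
    with hχ
  have hval : ∀ t j, (t, j) ∈ φ.dom → χ.toFun t j = φ.toFun t j := by
    intro t j h
    have hj : j ≠ J + 1 := by have := hmax t j h; omega
    simp [hχ, hj]
  have hintJ : interior (χ.flowInterval (J + 1)) = ∅ := by
    rw [show χ.flowInterval (J + 1) = {a} from Set.ext hJ, interior_singleton]
  have hintne : ∀ j, j ≠ J + 1 → χ.flowInterval j = φ.flowInterval j := fun j hj =>
    Set.ext fun r => hne r j hj
  have hsol : H.IsSolution χ := by
    refine ⟨?_, ?_, ?_, ?_⟩
    · rw [hval 0 0 φ.isHybridTimeDomain.zero_mem]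
      exact hφ.1.initial
    · intro j t ht
      by_cases hj : j = J + 1
      · subst hj
        rw [hintJ] at ht
        exact ht.elim
      · rw [hintne j hj] at ht
        simpa [hχ, hj] using hφ.1.mem_flowSet j t ht
    · intro j
      by_cases hj : j = J + 1
      · subst hj
        refine Filter.Eventually.of_forall fun t ht => ?_
        rw [hintJ] at ht
        exact ht.elim
      · rw [hintne j hj]
        simpa [hχ, hj] using hφ.1.flow j
    · intro t j h h'
      by_cases hj : j = J
      · subst hj
        obtain rfl := (hJ t).1 h'
        rw [hval _ _ ha]
        simpa [hχ] using And.intro hD hg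
      · have h'φ : (t, j + 1) ∈ φ.dom := (hne t _ (by omega)).1 h'
        have hφ' : (t, j) ∈ φ.dom := (hne t j (by have := hmax _ _ h'φ; omega)).1 h
        rw [hval _ _ hφ', hval _ _ h'φ]
        exact hφ.1.jump t j hφ' h'φ
  have := hφ.2 χ hsol Set.subset_union_left hval
  have hmem : (a, J + 1) ∈ φ.dom := by rw [← this]; exact (hJ a).2 rfl
  have := hmax _ _ hmem
  omega

end HybridSystem

/-! ### Flows, timers and completeness for the closed loop -/

theorem lipschitzWith_dz {m : ℕ} {ubar : Fin m → ℝ} (hubar : ∀ i, 0 < ubar i) :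
    LipschitzWith 2 (dz ubar) := by
  have hsat : ∀ u : ℝ, 0 < u → ∀ v : ℝ, min |v| u * Real.sign v = max (-u) (min u v) := by
    intro u hu v
    rcases lt_trichotomy v 0 with h | rfl | h
    · rw [Real.sign_of_neg h, abs_of_neg h, min_eq_right (by linarith : v ≤ u)]
      rcases le_total (-v) u with h' | h'
      · rw [min_eq_left h', max_eq_right (by linarith)]; ring
      · rw [min_eq_right h', max_eq_left (by linarith)]; ring
    · simp [hu.le]
    · rw [Real.sign_of_pos h, abs_of_pos h, mul_one, min_comm, max_eq_right]
      exact le_min (by linarith) (by linarith)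
  have h1 : LipschitzWith 1 (sat ubar) := by
    refine LipschitzWith.of_dist_le_mul fun v w => ?_
    rw [NNReal.coe_one, one_mul]
    refine (dist_pi_le_iff dist_nonneg).2 fun i => ?_
    refine le_trans ?_ (dist_le_pi_dist v w i)
    simp only [sat, hsat _ (hubar i), Real.dist_eq]
    have h2 := abs_max_sub_max_le_abs (min (ubar i) (v i)) (min (ubar i) (w i)) (-ubar i)
    have h3 := abs_min_sub_min_le_max (ubar i) (v i) (ubar i) (w i)
    rw [sub_self, abs_zero, max_eq_right (abs_nonneg _)] at h3
    rw [max_comm (-ubar i), max_comm (-ubar i)]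
    exact h2.trans h3
  have := h1.sub LipschitzWith.id
  rwa [one_add_one_eq_two] at this

namespace LoopData

variable {q m : ℕ} {n : Fin q → ℕ} {P : LoopData q m n}

theorem exists_lipschitzWith_flowMap (hubar : ∀ i, 0 < P.ubar i) :
    ∃ L, LipschitzWith L P.flowMap := by
  let e : StateSpace n ≃L[ℝ] XbarSpace n × EuclideanSpace ℝ (Fin q) :=
    WithLp.prodContinuousLinearEquiv 2 ℝ _ _
  let e' : XbarSpace n ≃L[ℝ] (PlantIdx n ⊕ PlantIdx n → ℝ) :=
    EuclideanSpace.equiv (PlantIdx n ⊕ PlantIdx n) ℝ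
  let p : StateSpace n →L[ℝ] (PlantIdx n ⊕ PlantIdx n → ℝ) :=
    e'.toContinuousLinearMap.comp (WithLp.fstL 2 ℝ _ _)
  have h1 := (P.Acl.mulVecLin.toContinuousLinearMap.comp p).lipschitz
  have h2 := P.Bcl.mulVecLin.toContinuousLinearMap.lipschitz.comp
    ((lipschitzWith_dz hubar).comp (P.Kcl.mulVecLin.toContinuousLinearMap.comp p).lipschitz)
  exact ⟨_, e.symm.lipschitz.comp ((e'.symm.lipschitz.comp (h1.add h2)).prodMk
    (LipschitzWith.const (WithLp.toLp 2 (fun _ => (-1 : ℝ)))))⟩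

/-- The `i`-th timer as a continuous linear functional of the state. -/
noncomputable def timerCoord (n : Fin q → ℕ) (i : Fin q) : StateSpace n →L[ℝ] ℝ :=
  (EuclideanSpace.proj i).comp (WithLp.sndL 2 ℝ (XbarSpace n) (EuclideanSpace ℝ (Fin q)))

theorem timerCoord_apply (i : Fin q) (x : StateSpace n) : timerCoord n i x = x.snd i := rfl

theorem isClosed_flowSet : IsClosed P.flowSet := by
  have : P.flowSet = ⋂ i, (timerCoord n i) ⁻¹' Set.Icc 0 (P.T₂ i) := by
    ext x
    simp only [Set.mem_iInter]
    rfl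
  rw [this]
  exact isClosed_iInter fun i => isClosed_Icc.preimage (timerCoord n i).continuous

theorem jumpSet_subset_flowSet : P.jumpSet ⊆ P.flowSet := fun _ ⟨_, hi⟩ => hi.1

theorem jumpMap_subset_flowSet (hT₁ : ∀ i, 0 < P.T₁ i) (x : StateSpace n) :
    P.jumpMap x ⊆ P.flowSet := by
  rintro g ⟨i, hi, -, -, hχ, hne⟩ k
  rcases eq_or_ne k i with rfl | hk
  · exact ⟨(hT₁ k).le.trans hχ.1, hχ.2⟩
  · rw [hne k hk]
    exact hi.1 k

theorem jumpMap_nonempty (hT₁₂ : ∀ i, P.T₁ i ≤ P.T₂ i) {x : StateSpace n} (hx : x ∈ P.jumpSet) :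
    (P.jumpMap x).Nonempty := by
  classical
  obtain ⟨i, hi⟩ := hx
  refine ⟨WithLp.toLp 2 (WithLp.toLp 2 (Sum.elim (fun s => x.fst (Sum.inl s))
    (resetBlock i fun r => x.fst (Sum.inr r))),
      WithLp.toLp 2 (Function.update x.snd.ofLp i (P.T₂ i))), i, hi, fun _ => rfl, fun _ => rfl,
    ?_, fun k hk => ?_⟩
  · simp [hT₁₂ i]
  · simp [hk]

/-- Along the flow, each timer decreases at unit rate. -/
theorem timer_eq_of_integralCurve {ψ : ℝ → StateSpace n} {a b : ℝ}
    (hψ : IsIntegralCurveOn ψ (fun _ => P.flowMap) (Set.Icc a b))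
    (i : Fin q) {t : ℝ} (ht : t ∈ Set.Icc a b) :
    (ψ t).snd i = (ψ a).snd i - (t - a) := by
  have := hψ.clm_apply_eq (timerCoord n i) (c := -1) (fun x => by simp [timerCoord_apply, flowMap])
    ht
  simp only [timerCoord_apply] at this
  linarith

variable {φ : HybridArc (StateSpace n)}

theorem toFun_mem_flowSet (hT₁ : ∀ i, 0 < P.T₁ i) (hφ : P.closedLoop.IsSolution φ)
    {t : ℝ} {j : ℕ} (h : (t, j) ∈ φ.dom) : φ.toFun t j ∈ P.flowSet :=
  hφ.toFun_mem_flowSet isClosed_flowSet jumpSet_subset_flowSet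
    (fun x _ => jumpMap_subset_flowSet hT₁ x) t j h

theorem isIntegralCurveOn_toFun (hubar : ∀ i, 0 < P.ubar i) (hφ : P.closedLoop.IsSolution φ)
    {a b : ℝ} {j : ℕ} (hab : a ≤ b) (ha : (a, j) ∈ φ.dom) (hb : (b, j) ∈ φ.dom) :
    IsIntegralCurveOn (fun s => φ.toFun s j) (fun _ => P.flowMap) (Set.Icc a b) :=
  hφ.isIntegralCurveOn (exists_lipschitzWith_flowMap hubar).choose_spec.continuous hab ha hb

theorem timer_eq (hubar : ∀ i, 0 < P.ubar i) (hφ : P.closedLoop.IsSolution φ)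
    {a b : ℝ} {j : ℕ} (hab : a ≤ b) (ha : (a, j) ∈ φ.dom) (hb : (b, j) ∈ φ.dom) (i : Fin q) :
    (φ.toFun b j).snd i = (φ.toFun a j).snd i - (b - a) :=
  timer_eq_of_integralCurve (isIntegralCurveOn_toFun hubar hφ hab ha hb) i ⟨hab, le_rfl⟩

/-- Each slice of the domain of a solution ends when the first later slice begins: at a jump some
timer vanishes, so that flowing on would make it negative. (The definition of hybrid time domains
alone does not exclude that a slice goes on after a jump.) -/
theorem time_le_of_slice_lt (hubar : ∀ i, 0 < P.ubar i) (hT₁ : ∀ i, 0 < P.T₁ i)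
    (hφ : P.closedLoop.IsSolution φ) {s t : ℝ} {i j : ℕ} (hij : i < j)
    (hs : (s, i) ∈ φ.dom) (ht : (t, j) ∈ φ.dom) : s ≤ t := by
  by_contra! hlt
  obtain ⟨r, hrt, hri, hri'⟩ := φ.isHybridTimeDomain.exists_jump_time hij ht
  obtain ⟨k, -, hk⟩ := (hφ.jump r i hri hri').1
  have h1 := timer_eq hubar hφ (hrt.trans hlt.le) hri hs k
  have h2 := (toFun_mem_flowSet hT₁ hφ hs k).1
  linarith

/-- The number of jumps is bounded by an affine function of the elapsed time. The quantity
`∑ i, τ i / T₁ i` is bounded, decreases at rate `∑ i, 1 / T₁ i` along the flow, and increases by at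
least `1` at each jump. -/
theorem jumps_le (hubar : ∀ i, 0 < P.ubar i) (hT₁ : ∀ i, 0 < P.T₁ i)
    (hφ : P.closedLoop.IsSolution φ) {t : ℝ} {j : ℕ} (h : (t, j) ∈ φ.dom) :
    (j : ℝ) ≤ (∑ i, 1 / P.T₁ i) * t + ∑ i, P.T₂ i / P.T₁ i := by
  have key := φ.isHybridTimeDomain.induction
    (p := fun t j => (j : ℝ) ≤ (∑ i, 1 / P.T₁ i) * t + ∑ i, (φ.toFun t j).snd i / P.T₁ i)
    ?_ ?_ ?_ t j h
  · refine key.trans ?_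
    gcongr with i
    · exact (hT₁ i).le
    · exact (toFun_mem_flowSet hT₁ hφ h i).2
  · have hC := toFun_mem_flowSet hT₁ hφ φ.isHybridTimeDomain.zero_mem
    have := Finset.sum_nonneg fun i (_ : i ∈ Finset.univ) => div_nonneg (hC i).1 (hT₁ i).le
    simpa using this
  · intro a b j hab ha hb hp
    refine hp.trans_eq ?_
    rw [Finset.sum_mul, Finset.sum_mul, ← Finset.sum_add_distrib, ← Finset.sum_add_distrib]
    refine Finset.sum_congr rfl fun i _ => ?_
    rw [timer_eq hubar hφ hab ha hb i]
    ring
  · intro t j h h' hp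
    obtain ⟨-, i, hi, -, -, hχ, hne⟩ := hφ.jump t j h h'
    have hdiff : 1 ≤ ∑ k, ((φ.toFun t (j + 1)).snd k / P.T₁ k - (φ.toFun t j).snd k / P.T₁ k) := by
      refine le_trans ?_ (Finset.single_le_sum (fun k _ => ?_) (Finset.mem_univ i))
      · rw [hi.2, zero_div, sub_zero, le_div_iff₀ (hT₁ i), one_mul]
        exact hχ.1
      · rcases eq_or_ne k i with rfl | hk
        · rw [hi.2, zero_div, sub_zero]
          exact div_nonneg ((hT₁ k).le.trans hχ.1) (hT₁ k).le
        · rw [hne k hk, sub_self]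
    rw [Finset.sum_sub_distrib] at hdiff
    push_cast
    linarith

/-- All maximal solutions are complete. If the domain were bounded, its last slice could be
prolonged by a global integral curve of the flow map, up to the time at which some timer vanishes;
at that time a jump is possible. -/
theorem isComplete_of_isMaximalSolution (hubar : ∀ i, 0 < P.ubar i) (hT₁ : ∀ i, 0 < P.T₁ i)
    (hT₁₂ : ∀ i, P.T₁ i ≤ P.T₂ i) (hφ : P.closedLoop.IsMaximalSolution φ) : φ.IsComplete := by
  intro hbdd
  obtain ⟨M, hM⟩ := hbdd.subset_closedBall ((0 : ℝ), 0)
  have hMt : ∀ t j, (t, j) ∈ φ.dom → t ≤ M ∧ (j : ℝ) ≤ M := by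
    intro t j h
    have := hM h
    rw [Metric.mem_closedBall, Prod.dist_eq, max_le_iff, Real.dist_eq, Nat.dist_eq] at this
    simp only [sub_zero, Nat.cast_zero, Nat.abs_cast] at this
    exact ⟨(le_abs_self t).trans this.1, this.2⟩
  obtain ⟨J, ⟨t₀, ht₀⟩, hmax⟩ : ∃ J, (∃ t, (t, J) ∈ φ.dom) ∧ ∀ r j, (r, j) ∈ φ.dom → j ≤ J := by
    have hne : {j | ∃ t, (t, j) ∈ φ.dom}.Nonempty := ⟨0, 0, φ.isHybridTimeDomain.zero_mem⟩
    have hbd : BddAbove {j | ∃ t, (t, j) ∈ φ.dom} :=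
      ⟨⌊M⌋₊, fun j ⟨t, h⟩ => Nat.le_floor (hMt t j h).2⟩
    exact ⟨_, Nat.sSup_mem hne hbd, fun r j h => le_csSup hbd ⟨r, h⟩⟩
  obtain ⟨a, ha, hstart, -, -⟩ := φ.isHybridTimeDomain.exists_slice_start ht₀
  have haC := toFun_mem_flowSet hT₁ hφ.1 ha
  -- `b` is the first time at which a timer vanishes; without timers, any late time will do.
  obtain ⟨b, hab, htimer, hlast, hcontra⟩ : ∃ b, a ≤ b ∧
      (∀ i, b - a ≤ (φ.toFun a J).snd i) ∧ (∀ r, (r, J) ∈ φ.dom → r ≤ b) ∧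
      (b, J) ∉ φ.dom := by
    rcases isEmpty_or_nonempty (Fin q) with hq | hq
    · refine ⟨M + 1, by linarith [(hMt a J ha).1], fun i => (hq.false i).elim,
        fun r hr => by linarith [(hMt r J hr).1], fun h => by linarith [(hMt _ J h).1]⟩
    · obtain ⟨i, -, hi⟩ := Finset.exists_min_image Finset.univ
        (fun i => (φ.toFun a J).snd i) Finset.univ_nonempty
      refine ⟨a + (φ.toFun a J).snd i, by linarith [(haC i).1],
        fun k => by linarith [hi k (Finset.mem_univ k)], fun r hr => ?_, fun hb => ?_⟩
      · have h1 := timer_eq hubar hφ.1 (hstart r hr) ha hr i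
        have h2 := (toFun_mem_flowSet hT₁ hφ.1 hr i).1
        linarith
      · have h1 := timer_eq hubar hφ.1 (hstart _ hb) ha hb i
        have hD : φ.toFun (a + (φ.toFun a J).snd i) J ∈ P.jumpSet :=
          ⟨i, toFun_mem_flowSet hT₁ hφ.1 hb, by rw [h1]; ring⟩
        obtain ⟨r, j, hr, hj⟩ := hφ.exists_mem_dom_succ hb hD (jumpMap_nonempty hT₁₂ hD)
        exact absurd (hmax r j hr) (by omega)
  obtain ⟨L, hL⟩ := exists_lipschitzWith_flowMap hubar
  obtain ⟨ψ, hψa, hψ⟩ := hL.exists_integralCurve (φ.toFun a J) hab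
  refine hcontra (hφ.mem_dom_of_integralCurve hL.continuous hab ha hmax
    (fun r j hr hj => time_le_of_slice_lt hubar hT₁ hφ.1 hj hr ha)
    (fun r hr => ⟨hstart r hr, hlast r hr⟩) hψ (fun t ht i => ?_) fun r hr => ?_)
  · have := timer_eq_of_integralCurve hψ i ht
    rw [hψa] at this
    rw [this]
    exact ⟨by linarith [htimer i, ht.2], by linarith [(haC i).2, ht.1]⟩
  · have hsub : Set.Icc a r ⊆ Set.Icc a b := Set.Icc_subset_Icc_right (hlast r hr)
    exact hL.integralCurve_unique (hψ.mono hsub)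
      (isIntegralCurveOn_toFun hubar hφ.1 (hstart r hr) ha hr) hψa ⟨hstart r hr, le_rfl⟩

end LoopData

/-! ### Lyapunov estimates and exponential stability -/

namespace LoopData

variable {q m : ℕ} {n : Fin q → ℕ} {P : LoopData q m n}

/-- On the flow set, the distance to the attractor is the norm of the component `x̄`. -/
theorem infDist_attractor {x : StateSpace n} (hx : x ∈ P.flowSet) :
    Metric.infDist x P.attractor = ‖x.fst‖ := by
  set y : StateSpace n := WithLp.toLp 2 (0, x.snd) with hy
  have hyA : y ∈ P.attractor := ⟨rfl, hx⟩
  refine le_antisymm ?_ ((Metric.le_infDist ⟨y, hyA⟩).2 fun z hz => ?_)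
  · refine (Metric.infDist_le_dist_of_mem hyA).trans_eq ?_
    rw [WithLp.prod_dist_eq_of_L2]
    simp [hy]
  · have h := WithLp.norm_fst_le (p := 2) _ (x - z)
    rwa [WithLp.sub_fst, hz.1, sub_zero, ← dist_eq_norm] at h

variable {V : StateSpace n → ℝ} {U : Set (XbarSpace n)} {k c₁ c₂ c₃ : ℝ}

/-- Some sublevel set of `V` at a positive level lies over the given neighborhood of the origin. -/
theorem exists_sublevel_subset (hU : U ∈ nhds (0 : XbarSpace n)) (hk : 0 < k) (hc₁ : 0 < c₁)
    (hlower : ∀ x ∈ P.flowSet, c₁ * Metric.infDist x P.attractor ^ k ≤ V x) :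
    ∃ c > 0, ∀ x ∈ P.flowSet, V x ≤ c → x.fst ∈ U := by
  obtain ⟨r, hr, hrU⟩ := Metric.mem_nhds_iff.1 hU
  refine ⟨c₁ * (r / 2) ^ k, by positivity, fun x hx hVx => hrU ?_⟩
  have h1 := le_of_mul_le_mul_left ((hlower x hx).trans hVx) hc₁
  rw [Real.rpow_le_rpow_iff Metric.infDist_nonneg (by positivity) hk, infDist_attractor hx] at h1
  rw [mem_ball_zero_iff]
  linarith

variable {φ : HybridArc (StateSpace n)}

/-- Along solutions that start in a sublevel set of `V` over `U`, `V` decays exponentially in the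
ordinary time `t`. -/
theorem lyapunov_le (hubar : ∀ i, 0 < P.ubar i) (hT₁ : ∀ i, 0 < P.T₁ i)
    (hV : Differentiable ℝ V) (hV0 : ∀ x ∈ P.flowSet, 0 ≤ V x) (hc₃ : 0 < c₃)
    (hflow : ∀ x : StateSpace n, x.fst ∈ U → x.snd ∈ P.timerSet →
      inner ℝ (gradient V x) (P.flowMap x) ≤ -c₃ * V x)
    (hjump : ∀ x ∈ P.jumpSet, ∀ g ∈ P.jumpMap x, V g - V x ≤ 0)
    {c : ℝ} (hc : 0 < c) (hcU : ∀ x ∈ P.flowSet, V x ≤ c → x.fst ∈ U)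
    (hφ : P.closedLoop.IsSolution φ) (h0 : V (φ.toFun 0 0) ≤ c) {t : ℝ} {j : ℕ}
    (h : (t, j) ∈ φ.dom) : V (φ.toFun t j) ≤ Real.exp (-c₃ * t) * V (φ.toFun 0 0) := by
  have hV00 := hV0 _ (toFun_mem_flowSet hT₁ hφ φ.isHybridTimeDomain.zero_mem)
  refine φ.isHybridTimeDomain.induction
    (p := fun t j => V (φ.toFun t j) ≤ Real.exp (-c₃ * t) * V (φ.toFun 0 0)) ?_ ?_ ?_ t j h
  · simp
  · intro a b j hab ha hb hp
    have ha0 : 0 ≤ a := φ.isHybridTimeDomain.2.1 _ ha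
    have hexp : Real.exp (-c₃ * a) ≤ 1 := Real.exp_le_one_iff.2 (by nlinarith)
    have hVa : V (φ.toFun a j) ≤ c :=
      (hp.trans (mul_le_of_le_one_left hV00 hexp)).trans h0
    have hdec := (isIntegralCurveOn_toFun hubar hφ hab ha hb).lyapunov_decay hab hV
      (C := P.flowSet) hc hc₃
      (fun t ht => toFun_mem_flowSet hT₁ hφ (φ.isHybridTimeDomain.mem_of_mem_Icc ha hb ht))
      (fun x hx hxc => hflow x (hcU x hx hxc) hx) hVa
    calc V (φ.toFun b j) ≤ Real.exp (-c₃ * (b - a)) * V (φ.toFun a j) := hdec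
      _ ≤ Real.exp (-c₃ * (b - a)) * (Real.exp (-c₃ * a) * V (φ.toFun 0 0)) := by gcongr
      _ = Real.exp (-c₃ * b) * V (φ.toFun 0 0) := by
        rw [← mul_assoc, ← Real.exp_add]; ring_nf
  · intro t j ht ht' hp
    obtain ⟨hD, hG⟩ := hφ.jump t j ht ht'
    have := hjump _ hD _ hG
    linarith

/-- The exponential estimate in hybrid time, with constants that do not depend on the sublevel set
in which the solution starts. Decay in `t` becomes decay in `t + j`, since `j` is bounded by an
affine function of `t`. -/
theorem exists_exponential_bound (hubar : ∀ i, 0 < P.ubar i) (hT₁ : ∀ i, 0 < P.T₁ i)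
    (hV : Differentiable ℝ V) (hk : 0 < k) (hc₁ : 0 < c₁) (hc₂ : 0 < c₂) (hc₃ : 0 < c₃)
    (hsandwich : ∀ x ∈ P.flowSet,
      c₁ * Metric.infDist x P.attractor ^ k ≤ V x ∧
        V x ≤ c₂ * Metric.infDist x P.attractor ^ k)
    (hflow : ∀ x : StateSpace n, x.fst ∈ U → x.snd ∈ P.timerSet →
      inner ℝ (gradient V x) (P.flowMap x) ≤ -c₃ * V x)
    (hjump : ∀ x ∈ P.jumpSet, ∀ g ∈ P.jumpMap x, V g - V x ≤ 0) :
    ∃ κ lam : ℝ, 0 < κ ∧ 0 < lam ∧ ∀ c > 0, (∀ x ∈ P.flowSet, V x ≤ c → x.fst ∈ U) →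
      ∀ φ : HybridArc (StateSpace n), P.closedLoop.IsSolution φ → V (φ.toFun 0 0) ≤ c →
        ∀ (t : ℝ) (j : ℕ), (t, j) ∈ φ.dom →
          Metric.infDist (φ.toFun t j) P.attractor ≤
            κ * Real.exp (-lam * (t + j)) * Metric.infDist (φ.toFun 0 0) P.attractor := by
  set ρ : ℝ := ∑ i, 1 / P.T₁ i with hρ
  set Q : ℝ := ∑ i, P.T₂ i / P.T₁ i with hQ
  have hρ0 : 0 ≤ ρ := Finset.sum_nonneg fun i _ => (one_div_pos.2 (hT₁ i)).le
  set lam : ℝ := c₃ / (k * (1 + ρ)) with hlam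
  have hlam0 : 0 < lam := by positivity
  have hlamρ : lam * (1 + ρ) = c₃ / k := by
    rw [hlam]; field_simp
  have hV0 : ∀ x ∈ P.flowSet, 0 ≤ V x := fun x hx =>
    le_trans (mul_nonneg hc₁.le (Real.rpow_nonneg Metric.infDist_nonneg k)) (hsandwich x hx).1
  refine ⟨(c₂ / c₁) ^ (1 / k) * Real.exp (lam * Q), lam, by positivity, hlam0,
    fun c hc hcU φ hφ h0 t j h => ?_⟩
  set d := Metric.infDist (φ.toFun t j) P.attractor with hd
  set d₀ := Metric.infDist (φ.toFun 0 0) P.attractor with hd₀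
  have hd0 : 0 ≤ d := Metric.infDist_nonneg
  have hd₀0 : 0 ≤ d₀ := Metric.infDist_nonneg
  have hdecay := lyapunov_le hubar hT₁ hV hV0 hc₃ hflow hjump hc hcU hφ h0 h
  have hlow := (hsandwich _ (toFun_mem_flowSet hT₁ hφ h)).1
  have hup := (hsandwich _ (toFun_mem_flowSet hT₁ hφ φ.isHybridTimeDomain.zero_mem)).2
  have hpow : d ^ k ≤ ((c₂ / c₁) ^ (1 / k) * Real.exp (-c₃ * t / k) * d₀) ^ k := by
    rw [Real.mul_rpow (by positivity) hd₀0, Real.mul_rpow (by positivity) (by positivity),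
      ← Real.rpow_mul (by positivity), ← Real.exp_mul, one_div_mul_cancel hk.ne', Real.rpow_one,
      div_mul_cancel₀ _ hk.ne']
    have : c₁ * d ^ k ≤ Real.exp (-c₃ * t) * (c₂ * d₀ ^ k) :=
      hlow.trans (hdecay.trans (by gcongr))
    rw [div_mul_eq_mul_div, div_mul_eq_mul_div, le_div_iff₀ hc₁]
    linarith
  have hdist := (Real.rpow_le_rpow_iff hd0 (by positivity) hk).1 hpow
  have hj := jumps_le hubar hT₁ hφ h
  have hexp : Real.exp (-c₃ * t / k) ≤ Real.exp (lam * Q) * Real.exp (-lam * (t + j)) := by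
    rw [← Real.exp_add, Real.exp_le_exp]
    have h1 : -c₃ * t / k = -(lam * (1 + ρ) * t) := by rw [hlamρ]; ring
    have h2 := mul_le_mul_of_nonneg_left hj hlam0.le
    rw [h1]
    linarith
  calc d ≤ (c₂ / c₁) ^ (1 / k) * Real.exp (-c₃ * t / k) * d₀ := hdist
    _ ≤ (c₂ / c₁) ^ (1 / k) * (Real.exp (lam * Q) * Real.exp (-lam * (t + j))) * d₀ := by gcongr
    _ = _ := by ring

end LoopData

theorem theorem2 {q m : ℕ} {n : Fin q → ℕ} (P : LoopData q m n)
    (hubar : ∀ i, 0 < P.ubar i)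
    (hT₁ : ∀ i, 0 < P.T₁ i) (hT₁₂ : ∀ i, P.T₁ i ≤ P.T₂ i)
    (V : StateSpace n → ℝ) (hV : ContDiff ℝ 1 V)
    (k c₁ c₂ c₃ : ℝ) (hk : 0 < k) (hc₁ : 0 < c₁) (hc₂ : 0 < c₂) (hc₃ : 0 < c₃)
    (U : Set (XbarSpace n)) (hU : U ∈ nhds (0 : XbarSpace n))
    (hsandwich : ∀ x ∈ P.flowSet,
      c₁ * Metric.infDist x P.attractor ^ k ≤ V x ∧
        V x ≤ c₂ * Metric.infDist x P.attractor ^ k)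
    (hflow : ∀ x : StateSpace n, x.fst ∈ U → x.snd ∈ P.timerSet →
      inner ℝ (gradient V x) (P.flowMap x) ≤ -c₃ * V x)
    (hjump : ∀ x ∈ P.jumpSet, ∀ g ∈ P.jumpMap x, V g - V x ≤ 0) :
    P.closedLoop.IsExponentiallyStable P.attractor ∧
      ∀ c : ℝ,
        {x ∈ P.flowSet | V x ≤ c} ⊆ {x : StateSpace n | x.fst ∈ U ∧ x.snd ∈ P.timerSet} →
        {x ∈ P.flowSet | V x ≤ c} ⊆ P.closedLoop.basinOfAttraction P.attractor := by
  obtain ⟨κ, lam, hκ, hlam, hbound⟩ := LoopData.exists_exponential_bound hubar hT₁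
    (hV.differentiable one_ne_zero) hk hc₁ hc₂ hc₃ hsandwich hflow hjump
  obtain ⟨c₀, hc₀, hc₀U⟩ := LoopData.exists_sublevel_subset hU hk hc₁ fun x hx => (hsandwich x hx).1
  constructor
  · -- The radius `(c₀ / c₂) ^ (1 / k)` makes `c₂ * |x|_𝒜 ^ k ≤ c₀`.
    refine ⟨κ, lam, (c₀ / c₂) ^ (1 / k), hκ, hlam, by positivity, fun φ hφ hφ0 =>
      ⟨LoopData.isComplete_of_isMaximalSolution hubar hT₁ hT₁₂ hφ,
        hbound c₀ hc₀ hc₀U φ hφ.1 ?_⟩⟩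
    have h0 := (hsandwich _ (LoopData.toFun_mem_flowSet hT₁ hφ.1
      φ.isHybridTimeDomain.zero_mem)).2
    have h1 := Real.rpow_le_rpow Metric.infDist_nonneg hφ0 hk.le
    rw [← Real.rpow_mul (by positivity), one_div_mul_cancel hk.ne', Real.rpow_one,
      le_div_iff₀ hc₂, mul_comm] at h1
    exact h0.trans h1
  · rintro c hcU ξ ⟨hξ, hξc⟩ φ hφ rfl
    refine ⟨LoopData.isComplete_of_isMaximalSolution hubar hT₁ hT₁₂ hφ, fun ε hε => ?_⟩
    -- The level `max c c₀` is admissible like `c` and `c₀`, and it is positive.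
    have hmaxU : ∀ x ∈ P.flowSet, V x ≤ max c c₀ → x.fst ∈ U := fun x hx hVx =>
      (le_max_iff.1 hVx).elim (fun h => (hcU ⟨hx, h⟩).1) (hc₀U x hx)
    have hest := hbound (max c c₀) (lt_max_of_lt_right hc₀) hmaxU φ hφ.1
      (hξc.trans (le_max_left _ _))
    have hlim : Filter.Tendsto (fun s : ℝ => κ * Real.exp (-lam * s) *
        Metric.infDist (φ.toFun 0 0) P.attractor) Filter.atTop (nhds 0) := by
      have h1 : Filter.Tendsto (fun s : ℝ => Real.exp (-lam * s)) Filter.atTop (nhds 0) :=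
        Real.tendsto_exp_atBot.comp
          ((Filter.tendsto_const_mul_atBot_of_neg (neg_lt_zero.2 hlam)).2 Filter.tendsto_id)
      simpa using (h1.const_mul κ).mul_const (Metric.infDist (φ.toFun 0 0) P.attractor)
    obtain ⟨N, hN⟩ := Filter.eventually_atTop.1 (hlim.eventually_lt_const hε)
    exact ⟨N, fun t j h hNt => (hest t j h).trans_lt (hN _ hNt)⟩
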